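/- Let $X$ be a uniformly locally finite metric space, i.e. $\sup_{x\in X}|\{y\in X: d(x,y)\le R\}|<\infty$ for every $R>0$. For $A\subseteq X$ let $1_A$ be the orthogonal projection of $\ell_2(X)$ onto $\ell_2(A)$. The quasi-local algebra $C^*_{ql}[X]$ consists of all bounded operators $u$ on $\ell_2(X)$ such that for every $\varepsilon>0$ there is $R>0$ with $\|1_Au1_B\|\le\varepsilon$ for all $A,B\subseteq X$ with $d(A,B)>R$. Suppose that $X$ contains a sequence of expanders: finite subsets $X_1,X_2,\dots$ of $X$, with the induced metrics, such that $|X_n|\to\infty$ and, for some $R>0$, $$\inf_n\ \min_{A\subseteq X_n,\ 0<|A|/|X_n|\le 1/2}\ \frac{|\{x\in X_n: d(x,A)\le R\}|}{|A|}>1 .$$ Then the $C^*$-algebra $\prod_n M_n$ (the $\ell_\infty$-direct sum of the complex matrix algebras $M_n=M_n(\mathbb C)$, with the operator norms) embeds into $C^*_{ql}[X]$, i.e. there is an injective, not necessarily unital, $*$-homomorphism $\prod_n M_n\to C^*_{ql}[X]$. More precisely, there are a subsequence $(X_{m(n)})_n$, with $m$ strictly increasing, and mutually orthogonal subspaces $V(n)\subseteq\ell_2(X_{m(n)})\subseteq\ell_2(X)$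 with $\dim V(n)=n$, such that the orthogonal projections $P_{V(n)}$ onto $V(n)$ satisfy $$\|P_{V(n)}1_E\|<100\sqrt{\tfrac1k\log k}\qquad\text{whenever } 2\le k\le n,\ E\subseteq X_{m(n)},\ |E|/|X_{m(n)}|\le \tfrac1k ,$$ and such that $\prod_n B(V(n))$, the algebra of all bounded operators on $\ell_2(X)$ that map each $V(n)$ into itself and vanish on the orthogonal complement of all the $V(n)$, is the range of an injective $*$-homomorphism $\prod_n M_n\to C^*_{ql}[X]$. -/

import Mathlib

open scoped ENNReal InnerProductSpace Matrix.Norms.L2Operator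

noncomputable section

/-- A metric space is uniformly locally finite if, for every `R > 0`, the cardinalities of the
closed balls of radius `R` are finite and bounded independently of the centre. -/
def UniformlyLocallyFinite (X : Type*) [MetricSpace X] : Prop :=
  ∀ R : ℝ, 0 < R → ∃ N : ℕ, ∀ x : X, (Metric.closedBall x R).encard ≤ N

/-- The complex Hilbert space `ℓ²(X)`. -/
abbrev Ell2 (X : Type*) : Type _ := lp (fun _ : X => ℂ) 2

/-- The C⋆-algebra of bounded operators on `ℓ²(X)`. -/
abbrev BEll2 (X : Type*) : Type _ := Ell2 X →L[ℂ] Ell2 X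

section Coordinates

variable {X : Type*}

/-- The subspace `ℓ²(A)` of `ℓ²(X)`: the vectors that vanish outside `A`. -/
def ell2On (A : Set X) : Submodule ℂ (Ell2 X) where
  carrier := {f | ∀ x, x ∉ A → f x = 0}
  add_mem' := by
    intro f g hf hg x hx
    have h1 := hf x hx
    have h2 := hg x hx
    simp [h1, h2]
  zero_mem' := by
    intro x _
    simp
  smul_mem' := by
    intro c f hf x hx
    have h1 := hf x hx
    simp [h1]

theorem mem_ell2On {A : Set X} {f : Ell2 X} : f ∈ ell2On A ↔ ∀ x, x ∉ A → f x = 0 := Iff.rfl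

theorem inner_single_one [DecidableEq X] (x : X) (f : Ell2 X) :
    ⟪(lp.single 2 x (1 : ℂ) : Ell2 X), f⟫_ℂ = f x := by
  rw [lp.inner_single_left]
  simp

theorem ell2On_orthogonal (A : Set X) : (ell2On A)ᗮ = ell2On Aᶜ := by
  classical
  ext f
  rw [Submodule.mem_orthogonal, mem_ell2On]
  constructor
  · intro h x hx
    rw [← inner_single_one x f]
    refine h _ ?_
    intro y hy
    have hxA : x ∈ A := by simpa using hx
    have hne : y ≠ x := fun e => hy (e ▸ hxA)
    simp [lp.single_apply, hne]
  · intro h g hg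
    rw [lp.inner_eq_tsum]
    have h0 : ∀ x, ⟪g x, f x⟫_ℂ = 0 := by
      intro x
      by_cases hx : x ∈ A
      · rw [h x (by simpa using hx), inner_zero_right]
      · rw [hg x hx, inner_zero_left]
    rw [tsum_congr h0, tsum_zero]

theorem isClosed_ell2On (A : Set X) : IsClosed (ell2On A : Set (Ell2 X)) := by
  have h : ell2On A = (ell2On Aᶜ)ᗮ := by rw [ell2On_orthogonal, compl_compl]
  rw [h]
  exact Submodule.isClosed_orthogonal _

instance instHasOrthogonalProjectionEll2On (A : Set X) :
    (ell2On A).HasOrthogonalProjection := by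
  have : CompleteSpace (ell2On A) := (isClosed_ell2On A).completeSpace_coe
  infer_instance

/-- The orthogonal projection `1_A` of `ℓ²(X)` onto `ℓ²(A)`, as an operator on `ℓ²(X)`. -/
def coordProj (A : Set X) : BEll2 X := (ell2On A).starProjection

theorem star_coordProj (A : Set X) : star (coordProj A) = coordProj A :=
  isSelfAdjoint_starProjection (ell2On A)

theorem norm_coordProj_le (A : Set X) : ‖coordProj A‖ ≤ 1 :=
  (ell2On A).starProjection_norm_le

theorem coordProj_add_compl (A : Set X) : coordProj A + coordProj Aᶜ = 1 := by
  have h : (ell2On A).starProjection + (ell2On A)ᗮ.starProjection = 1 := by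
    rw [Submodule.starProjection_orthogonal']
    simp
  have h2 : (ell2On A)ᗮ.starProjection = coordProj Aᶜ := by
    unfold coordProj
    congr 1
    exact ell2On_orthogonal A
  rw [← h2]
  exact h

theorem coordProj_mul_of_disjoint {A B : Set X} (h : Disjoint A B) :
    coordProj A * coordProj B = 0 := by
  ext1 f
  have hB : coordProj B f ∈ ell2On B := Submodule.starProjection_apply_mem _ _
  have hA : coordProj B f ∈ (ell2On A)ᗮ := by
    rw [ell2On_orthogonal]
    intro x hx
    exact hB x fun hxB => Set.disjoint_left.1 h (by simpa using hx) hxB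
  exact (Submodule.starProjection_apply_eq_zero_iff _).2 hA

theorem norm_coordProj_mul_mul_le (A B : Set X) (u : BEll2 X) :
    ‖coordProj A * u * coordProj B‖ ≤ ‖u‖ := by
  have hA := norm_coordProj_le A
  have hB := norm_coordProj_le B
  calc ‖coordProj A * u * coordProj B‖ ≤ ‖coordProj A‖ * ‖u‖ * ‖coordProj B‖ :=
        (norm_mul_le _ _).trans (by gcongr; exact norm_mul_le _ _)
    _ ≤ 1 * ‖u‖ * 1 := by gcongr
    _ = ‖u‖ := by ring

end Coordinates

section QuasiLocal

variable {X : Type*} [MetricSpace X]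

/-- The distance `dist(A, B)` between two sets: the infimum of the distances between their points,
which is `∞` if one of the sets is empty. -/
def setDist (A B : Set X) : ℝ≥0∞ := ⨅ a ∈ A, ⨅ b ∈ B, edist a b

/-- `u` has `ε`-propagation at most `R`: `‖1_A u 1_B‖ ≤ ε` whenever `dist(A, B) > R`. -/
def HasEpsPropagationLE (u : BEll2 X) (ε R : ℝ) : Prop :=
  ∀ A B : Set X, ENNReal.ofReal R < setDist A B → ‖coordProj A * u * coordProj B‖ ≤ ε

/-- `u` is quasi-local if it has finite `ε`-propagation for all `ε > 0`. -/
def IsQuasiLocal (u : BEll2 X) : Prop :=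
  ∀ ε : ℝ, 0 < ε → ∃ R : ℝ, 0 < R ∧ HasEpsPropagationLE u ε R

theorem setDist_comm (A B : Set X) : setDist A B = setDist B A := by
  unfold setDist
  rw [iInf₂_comm]
  simp only [edist_comm]

theorem lt_dist_of_lt_setDist {A B : Set X} {R : ℝ} (h : ENNReal.ofReal R < setDist A B)
    {a b : X} (ha : a ∈ A) (hb : b ∈ B) : R < dist a b := by
  have h1 : setDist A B ≤ edist a b := (iInf₂_le a ha).trans (iInf₂_le b hb)
  have h2 := h.trans_le h1
  rw [edist_dist] at h2
  exact (ENNReal.ofReal_lt_ofReal_iff').1 h2 |>.1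

theorem lt_setDist_of_le_dist {A B : Set X} {R S : ℝ} (hR : 0 < R) (hRS : R < S)
    (h : ∀ a ∈ A, ∀ b ∈ B, S ≤ dist a b) : ENNReal.ofReal R < setDist A B := by
  refine lt_of_lt_of_le ((ENNReal.ofReal_lt_ofReal_iff (hR.trans hRS)).2 hRS) ?_
  refine le_iInf₂ fun a ha => le_iInf₂ fun b hb => ?_
  rw [edist_dist]
  exact ENNReal.ofReal_le_ofReal (h a ha b hb)

theorem HasEpsPropagationLE.mono {u : BEll2 X} {ε R S : ℝ} (h : HasEpsPropagationLE u ε R)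
    (hRS : R ≤ S) : HasEpsPropagationLE u ε S := fun A B hAB =>
  h A B ((ENNReal.ofReal_le_ofReal hRS).trans_lt hAB)

theorem IsQuasiLocal.add {u v : BEll2 X} (hu : IsQuasiLocal u) (hv : IsQuasiLocal v) :
    IsQuasiLocal (u + v) := by
  intro ε hε
  obtain ⟨R, hR, h1⟩ := hu (ε / 2) (by positivity)
  obtain ⟨S, hS, h2⟩ := hv (ε / 2) (by positivity)
  refine ⟨max R S, lt_max_of_lt_left hR, fun A B hAB => ?_⟩
  have e1 := h1.mono (le_max_left R S) A B hAB
  have e2 := h2.mono (le_max_right R S) A B hAB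
  rw [mul_add, add_mul]
  refine (norm_add_le _ _).trans ?_
  linarith

theorem IsQuasiLocal.mul {u v : BEll2 X} (hu : IsQuasiLocal u) (hv : IsQuasiLocal v) :
    IsQuasiLocal (u * v) := by
  intro ε hε
  have hMpos : 0 < ‖u‖ + ‖v‖ + 1 := by positivity
  obtain ⟨R, hR, h1⟩ := hu (ε / (‖u‖ + ‖v‖ + 1)) (by positivity)
  obtain ⟨S, hS, h2⟩ := hv (ε / (‖u‖ + ‖v‖ + 1)) (by positivity)
  refine ⟨R + S + 2, by positivity, fun A B hAB => ?_⟩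
  let C : Set X := {x | ∃ a ∈ A, dist a x ≤ R + 1}
  have hC : ENNReal.ofReal S < setDist C B := by
    refine lt_setDist_of_le_dist hS (lt_add_one S) ?_
    rintro c ⟨a, ha, hac⟩ b hb
    have e1 := lt_dist_of_lt_setDist hAB ha hb
    have e2 := dist_triangle a c b
    linarith
  have hC' : ENNReal.ofReal R < setDist A Cᶜ := by
    refine lt_setDist_of_le_dist hR (lt_add_one R) ?_
    intro a ha c hc
    by_contra hlt
    exact hc ⟨a, ha, (not_le.1 hlt).le⟩
  have e1 := h1 A Cᶜ hC'
  have e2 := h2 C B hC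
  have hsplit : coordProj A * (u * v) * coordProj B =
      coordProj A * u * (coordProj C * v * coordProj B) +
        coordProj A * u * coordProj Cᶜ * (v * coordProj B) := by
    have h := coordProj_add_compl C
    calc coordProj A * (u * v) * coordProj B =
        coordProj A * u * 1 * v * coordProj B := by noncomm_ring
      _ = _ := by rw [← h]; noncomm_ring
  have nA := norm_coordProj_le A
  have nB := norm_coordProj_le B
  have f1 : ‖coordProj A * u‖ ≤ ‖u‖ := (norm_mul_le _ _).trans
    (mul_le_of_le_one_left (norm_nonneg _) nA)
  have f2 : ‖v * coordProj B‖ ≤ ‖v‖ := (norm_mul_le _ _).trans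
    (mul_le_of_le_one_right (norm_nonneg _) nB)
  have hδ : 0 ≤ ε / (‖u‖ + ‖v‖ + 1) := by positivity
  rw [hsplit]
  calc _ ≤ ‖coordProj A * u‖ * ‖coordProj C * v * coordProj B‖ +
        ‖coordProj A * u * coordProj Cᶜ‖ * ‖v * coordProj B‖ :=
        (norm_add_le _ _).trans (add_le_add (norm_mul_le _ _) (norm_mul_le _ _))
    _ ≤ ‖u‖ * (ε / (‖u‖ + ‖v‖ + 1)) + ε / (‖u‖ + ‖v‖ + 1) * ‖v‖ := by gcongr
    _ = (‖u‖ + ‖v‖ + 1) * (ε / (‖u‖ + ‖v‖ + 1)) - ε / (‖u‖ + ‖v‖ + 1) := by ring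
    _ = ε - ε / (‖u‖ + ‖v‖ + 1) := by rw [mul_div_cancel₀ _ hMpos.ne']
    _ ≤ ε := by linarith

theorem IsQuasiLocal.algebraMap (c : ℂ) : IsQuasiLocal (algebraMap ℂ (BEll2 X) c) := by
  intro ε hε
  refine ⟨1, one_pos, fun A B hAB => ?_⟩
  have hdisj : Disjoint A B := Set.disjoint_left.2 fun x hA hB => by
    have := lt_dist_of_lt_setDist hAB hA hB
    rw [dist_self] at this
    linarith
  rw [Algebra.algebraMap_eq_smul_one, mul_smul_comm, mul_one, smul_mul_assoc,
    coordProj_mul_of_disjoint hdisj, smul_zero, norm_zero]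
  exact hε.le

theorem IsQuasiLocal.star {u : BEll2 X} (hu : IsQuasiLocal u) : IsQuasiLocal (star u) := by
  intro ε hε
  obtain ⟨R, hR, h⟩ := hu ε hε
  refine ⟨R, hR, fun A B hAB => ?_⟩
  have e := h B A (by rwa [setDist_comm])
  rw [← norm_star] at e
  simpa only [star_mul, star_coordProj, mul_assoc] using e

variable (X) in
/-- The quasi-local algebra of `X`: the ⋆-subalgebra of the bounded operators on `ℓ²(X)` that
consists of all quasi-local operators. -/
def quasiLocalAlgebra : StarSubalgebra ℂ (BEll2 X) where
  carrier := {u | IsQuasiLocal u}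
  mul_mem' := IsQuasiLocal.mul
  add_mem' := IsQuasiLocal.add
  algebraMap_mem' := IsQuasiLocal.algebraMap
  star_mem' := IsQuasiLocal.star

/-- The quasi-local algebra is norm closed, hence a C⋆-algebra. -/
theorem isClosed_quasiLocalAlgebra : IsClosed (quasiLocalAlgebra X : Set (BEll2 X)) := by
  refine isClosed_of_closure_subset fun u hu => ?_
  intro ε hε
  obtain ⟨v, hv, huv⟩ := Metric.mem_closure_iff.1 hu (ε / 2) (by positivity)
  obtain ⟨R, hR, h⟩ := (show IsQuasiLocal v from hv) (ε / 2) (by positivity)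
  refine ⟨R, hR, fun A B hAB => ?_⟩
  have e1 := h A B hAB
  have e2 := norm_coordProj_mul_mul_le A B (u - v)
  rw [dist_eq_norm] at huv
  have e3 : coordProj A * u * coordProj B =
      coordProj A * (u - v) * coordProj B + coordProj A * v * coordProj B := by noncomm_ring
  rw [e3]
  refine (norm_add_le _ _).trans ?_
  linarith

/-- A sequence of finite subsets `Y n` of `X`, with the metrics induced from `X`, is a sequence of
expanders if `|Y n| → ∞` and, for some `R > 0` and `κ > 1`, every nonempty `A ⊆ Y n` with
`|A| / |Y n| ≤ 1 / 2` satisfies `|{x ∈ Y n : dist(x, A) ≤ R}| / |A| ≥ κ`. -/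
def IsExpanderSequence (Y : ℕ → Finset X) : Prop :=
  Filter.Tendsto (fun n => (Y n).card) Filter.atTop Filter.atTop ∧
  ∃ R : ℝ, 0 < R ∧ ∃ κ : ℝ, 1 < κ ∧
    ∀ n, ∀ A ⊆ Y n, A.Nonempty → (A.card : ℝ) / ((Y n).card : ℝ) ≤ 1 / 2 →
      κ ≤ ({x ∈ (Y n : Set X) | Metric.infDist x (A : Set X) ≤ R}.ncard : ℝ) / (A.card : ℝ)

end QuasiLocal

/-- The C⋆-algebra `∏_n M_n`: the norm-bounded sequences `(a_n)` of complex `n × n` matrices, with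
the operator norm on each matrix algebra, the supremum norm and the entrywise operations. (The index
`n = 0` contributes only the zero algebra.) -/
abbrev MatrixProduct : Type := lp (fun n : ℕ => Matrix (Fin n) (Fin n) ℂ) ∞

/-- For mutually orthogonal subspaces `V n` of a Hilbert space `H`, the algebra `∏_n B(V n)` of
block diagonal operators on `H`: the bounded operators that map each `V n` into itself and vanish on
the orthogonal complement of all the `V n`. -/
def blockDiagonalOperators {H : Type*} [NormedAddCommGroup H] [InnerProductSpace ℂ H]
    (V : ℕ → Submodule ℂ H) : Set (H →L[ℂ] H) :=
  {u | (∀ n, ∀ v ∈ V n, u v ∈ V n) ∧ ∀ w ∈ (⨆ n, V n)ᗮ, u w = 0}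

end

/-! If `A` and `B` are far apart, expansion forces one of them to occupy at most a proportion `1/k`
of each `Y n`, with a distance threshold that depends on `k` but not on `n`
(`IsExpanderSequence.exists_dist`). So it suffices to find subspaces `V n` whose unit vectors are
spread out: on every set of proportion at most `1/k` they carry only `O(log k / k)` of their squared
norm. For a block diagonal `u`, each block of `1_A u 1_B` is then `O(√(log k / k)) ‖u‖`. The blocks
live on disjoint sets, so Cauchy–Schwarz sums them without loss (`norm_coordProj_blockOperator_le`),
and `u` is quasi-local.

The spread subspaces are spanned by Rademacher functions (`exists_spread_isometry`). Label points by
sign vectors in `{±1}ⁿ`, each used `q` times; the `n` coordinate functions are then orthogonal with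
equal norms. A normalized real combination is sub-Gaussian, so its values exceed `√(2 log k)` so
rarely that this excess contributes only `O(log k / k)` of the squared norm. The remaining values
contribute at most `2 log k` per point of the small set.

Disjoint supports come from a fast growing subsequence: deleting the earlier sets and rounding down
to a multiple of `2ⁿ` costs at most half of the points (`exists_disjoint_subsequence`). -/

noncomputable section

/-! ### Rademacher sums: orthogonality, sub-Gaussian tails, mass on small sets. -/

/-- The sign `±1` encoded by a boolean. -/
def boolSign (b : Bool) : ℝ := if b then 1 else -1

theorem boolSign_mul_self (b : Bool) : boolSign b * boolSign b = 1 := by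
  cases b <;> simp [boolSign]

theorem boolSign_not (b : Bool) : boolSign (!b) = -boolSign b := by
  cases b <;> simp [boolSign]

/-- For `i ≠ j`, flipping the `i`-th sign is a fixed-point-free involution that negates the summand.
-/
theorem sum_boolSign_mul_boolSign {ι : Type*} [Fintype ι] [DecidableEq ι] (i j : ι) :
    ∑ b : ι → Bool, boolSign (b i) * boolSign (b j) =
      if i = j then 2 ^ Fintype.card ι else 0 := by
  split_ifs with h
  · subst h
    simp [boolSign_mul_self]
  · refine Finset.sum_involution (fun b _ => Function.update b i (!b i)) ?_ ?_ ?_ ?_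
    · intro b _
      simp [Function.update_of_ne (Ne.symm h), boolSign_not]
    · intro b _ _ he
      have := congrFun he i
      simp at this
    · simp
    · intro b _
      simp

/-- The coordinate functions on the discrete cube are orthogonal. -/
theorem sum_sq_rademacher {ι : Type*} [Fintype ι] [DecidableEq ι] (a : ι → ℝ) :
    ∑ b : ι → Bool, (∑ i, boolSign (b i) * a i) ^ 2 = 2 ^ Fintype.card ι * ∑ i, a i ^ 2 := by
  have h : ∀ b : ι → Bool, (∑ i, boolSign (b i) * a i) ^ 2 =
      ∑ i, ∑ j, boolSign (b i) * boolSign (b j) * (a i * a j) := by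
    intro b
    rw [sq, Finset.sum_mul_sum]
    refine Finset.sum_congr rfl fun i _ => Finset.sum_congr rfl fun j _ => by ring
  simp_rw [h]
  rw [Finset.sum_comm]
  simp_rw [Finset.sum_comm (s := (Finset.univ : Finset (ι → Bool))), ← Finset.sum_mul,
    sum_boolSign_mul_boolSign]
  rw [Finset.mul_sum]
  refine Finset.sum_congr rfl fun i _ => ?_
  simp [sq]

/-- Rademacher sums are sub-Gaussian. -/
theorem sum_exp_rademacher_le {ι : Type*} [Fintype ι] [DecidableEq ι] (a : ι → ℝ)
    (ha : ∑ i, a i ^ 2 ≤ 1) (T : ℝ) :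
    ∑ b : ι → Bool, Real.exp (T * ∑ i, boolSign (b i) * a i) ≤
      2 ^ Fintype.card ι * Real.exp (T ^ 2 / 2) := by
  have h : ∀ b : ι → Bool, Real.exp (T * ∑ i, boolSign (b i) * a i) =
      ∏ i, Real.exp (boolSign (b i) * (T * a i)) := by
    intro b
    rw [← Real.exp_sum, Finset.mul_sum]
    congr 1
    exact Finset.sum_congr rfl fun i _ => by ring
  simp_rw [h]
  have h2 := Finset.prod_univ_sum (fun _ : ι => (Finset.univ : Finset Bool))
    (fun i c => Real.exp (boolSign c * (T * a i)))
  rw [Fintype.piFinset_univ] at h2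
  rw [← h2]
  calc ∏ i, ∑ c, Real.exp (boolSign c * (T * a i))
      ≤ ∏ i, 2 * Real.exp ((T * a i) ^ 2 / 2) := by
        refine Finset.prod_le_prod (fun i _ => Finset.sum_nonneg fun c _ => (Real.exp_pos _).le)
          fun i _ => ?_
        have := Real.cosh_le_exp_half_sq (T * a i)
        rw [Real.cosh_eq] at this
        simp only [Fintype.sum_bool, boolSign, if_true, one_mul, Bool.false_eq_true, if_false,
          neg_mul]
        linarith
    _ = 2 ^ Fintype.card ι * Real.exp (T ^ 2 / 2 * ∑ i, a i ^ 2) := by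
        rw [Finset.prod_mul_distrib, ← Real.exp_sum, Finset.mul_sum]
        simp only [Finset.prod_const, Finset.card_univ]
        congr 2
        exact Finset.sum_congr rfl fun i _ => by ring
    _ ≤ _ := by
        gcongr
        exact mul_le_of_le_one_right (by positivity) ha

/-- A tail bound in pointwise form. For `0 ≤ s ≤ T` it is trivial; for `s = T y` with `y ≥ 1`, `exp
(-T² + T s) = exp (T² (y - 1)) ≥ exp (y - 1) ≥ (1 + y²) / 2`. The weight `exp (-T²)` is chosen
against the moment bound `exp (T² / 2)`, leaving `exp (-T² / 2)`. -/
theorem sq_le_of_one_le {T : ℝ} (hT : 1 ≤ T) (s : ℝ) :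
    s ^ 2 ≤ T ^ 2 * (1 + 2 * (Real.exp (-T ^ 2) * (Real.exp (T * s) + Real.exp (-T * s)))) := by
  wlog hs : 0 ≤ s generalizing s
  · have := this (-s) (by linarith)
    rw [neg_sq, mul_neg, neg_mul_neg] at this
    rw [neg_mul, add_comm (Real.exp (T * s))]
    exact this
  have hT0 : 0 < T := by linarith
  have key : s ^ 2 ≤ T ^ 2 * (1 + 2 * (Real.exp (-T ^ 2) * Real.exp (T * s))) := by
    rw [← Real.exp_add]
    rcases le_total s T with h | h
    · have : 0 ≤ Real.exp (-T ^ 2 + T * s) := (Real.exp_pos _).le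
      nlinarith [sq_nonneg T]
    · set y := s / T with hy
      have hsy : s = T * y := by rw [hy]; field_simp
      have hy1 : 1 ≤ y := (one_le_div hT0).2 h
      have e1 : y - 1 ≤ -T ^ 2 + T * s := by
        rw [hsy]
        nlinarith [mul_nonneg (by nlinarith : 0 ≤ T ^ 2 - 1) (by linarith : 0 ≤ y - 1)]
      have e2 := Real.quadratic_le_exp_of_nonneg (by linarith : 0 ≤ y - 1)
      have e3 := Real.exp_le_exp.2 e1
      have e4 : y ^ 2 ≤ 1 + 2 * Real.exp (-T ^ 2 + T * s) := by nlinarith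
      calc s ^ 2 = T ^ 2 * y ^ 2 := by rw [hsy]; ring
        _ ≤ _ := by gcongr
  refine key.trans ?_
  gcongr
  exact le_add_of_nonneg_right (Real.exp_pos _).le

/-- If the signs are equidistributed over `S`, then a Rademacher sum carries little mass on small
subsets of `S`. -/
theorem sum_sq_rademacher_subset_le {X : Type*} {n q : ℕ} {S E : Finset X} (hE : E ⊆ S)
    {g : X → Fin n → Bool}
    (hg : ∀ F : (Fin n → Bool) → ℝ, ∑ x ∈ S, F (g x) = q * ∑ b, F b)
    {a : Fin n → ℝ} (ha : ∑ i, a i ^ 2 ≤ 1) {T : ℝ} (hT : 1 ≤ T) :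
    ∑ x ∈ E, (∑ i, boolSign (g x i) * a i) ^ 2 ≤
      T ^ 2 * (E.card + 4 * Real.exp (-T ^ 2 / 2) * (q * 2 ^ n)) := by
  set s : (Fin n → Bool) → ℝ := fun b => ∑ i, boolSign (b i) * a i with hs
  have e1 : ∑ b, Real.exp (T * s b) ≤ 2 ^ n * Real.exp (T ^ 2 / 2) := by
    simpa using sum_exp_rademacher_le a ha T
  have e2 : ∑ b, Real.exp (-T * s b) ≤ 2 ^ n * Real.exp (T ^ 2 / 2) := by
    simpa using sum_exp_rademacher_le a ha (-T)
  have e3 : Real.exp (-T ^ 2) * Real.exp (T ^ 2 / 2) = Real.exp (-T ^ 2 / 2) := by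
    rw [← Real.exp_add]; congr 1; ring
  calc ∑ x ∈ E, (s (g x)) ^ 2
      ≤ ∑ x ∈ E, T ^ 2 * (1 + 2 * (Real.exp (-T ^ 2) *
          (Real.exp (T * s (g x)) + Real.exp (-T * s (g x))))) :=
        Finset.sum_le_sum fun x _ => sq_le_of_one_le hT _
    _ = T ^ 2 * (E.card + 2 * Real.exp (-T ^ 2) *
          ∑ x ∈ E, (Real.exp (T * s (g x)) + Real.exp (-T * s (g x)))) := by
        rw [← Finset.mul_sum, Finset.sum_add_distrib, ← Finset.mul_sum, ← Finset.mul_sum]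
        simp [mul_assoc]
    -- Only the tail term is enlarged from `E` to `S`, where equidistribution evaluates it as a sum
    -- over the cube; the main term keeps `E.card`.
    _ ≤ T ^ 2 * (E.card + 2 * Real.exp (-T ^ 2) *
          ∑ x ∈ S, (Real.exp (T * s (g x)) + Real.exp (-T * s (g x)))) := by
        gcongr
    _ = T ^ 2 * (E.card + 2 * Real.exp (-T ^ 2) *
          (q * (∑ b, Real.exp (T * s b) + ∑ b, Real.exp (-T * s b)))) := by
        rw [hg fun b => Real.exp (T * s b) + Real.exp (-T * s b), Finset.sum_add_distrib]
    _ ≤ T ^ 2 * (E.card + 2 * Real.exp (-T ^ 2) *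
          (q * (2 ^ n * Real.exp (T ^ 2 / 2) + 2 ^ n * Real.exp (T ^ 2 / 2)))) := by
        gcongr
    _ = _ := by rw [← e3]; ring

theorem norm_sq_sum_boolSign {n : ℕ} (b : Fin n → Bool) (a : Fin n → ℂ) :
    ‖∑ i, (boolSign (b i) : ℂ) * a i‖ ^ 2 =
      (∑ i, boolSign (b i) * (a i).re) ^ 2 + (∑ i, boolSign (b i) * (a i).im) ^ 2 := by
  rw [Complex.sq_norm, Complex.normSq_apply]
  simp [Complex.re_sum, Complex.im_sum, sq]

theorem norm_sq_euclidean_eq {n : ℕ} (a : EuclideanSpace ℂ (Fin n)) :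
    ‖a‖ ^ 2 = ∑ i, (a i).re ^ 2 + ∑ i, (a i).im ^ 2 := by
  rw [EuclideanSpace.norm_sq_eq, ← Finset.sum_add_distrib]
  refine Finset.sum_congr rfl fun i _ => ?_
  rw [Complex.sq_norm, Complex.normSq_apply]
  ring

theorem sum_norm_sq_rademacher {X : Type*} {n q : ℕ} {S : Finset X} {g : X → Fin n → Bool}
    (hg : ∀ F : (Fin n → Bool) → ℝ, ∑ x ∈ S, F (g x) = q * ∑ b, F b)
    (a : EuclideanSpace ℂ (Fin n)) :
    ∑ x ∈ S, ‖∑ i, (boolSign (g x i) : ℂ) * a i‖ ^ 2 = q * 2 ^ n * ‖a‖ ^ 2 := by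
  rw [hg fun b => ‖∑ i, (boolSign (b i) : ℂ) * a i‖ ^ 2]
  simp_rw [norm_sq_sum_boolSign]
  rw [Finset.sum_add_distrib, sum_sq_rademacher, sum_sq_rademacher, norm_sq_euclidean_eq]
  simp only [Fintype.card_fin]
  ring

/-- By homogeneity `a` may have norm one; the real bound then applies to its real and imaginary
parts. The factor `2` in the size of `E` absorbs the points lost when the expander is cut down to `q
* 2 ^ n` points. -/
theorem sum_norm_sq_rademacher_subset_le {X : Type*} {n q : ℕ} {S E : Finset X} (hE : E ⊆ S)
    {g : X → Fin n → Bool}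
    (hg : ∀ F : (Fin n → Bool) → ℝ, ∑ x ∈ S, F (g x) = q * ∑ b, F b)
    {k : ℕ} (hk : 2 ≤ k) (hcard : (E.card : ℝ) ≤ 2 * (q * 2 ^ n) / k)
    (a : EuclideanSpace ℂ (Fin n)) :
    ∑ x ∈ E, ‖∑ i, (boolSign (g x i) : ℂ) * a i‖ ^ 2 ≤
      24 * (1 / k * Real.log k) * (q * 2 ^ n) * ‖a‖ ^ 2 := by
  have hk2 : (2 : ℝ) ≤ k := by exact_mod_cast hk
  have hlog : 1 / 2 ≤ Real.log k := by
    have h1 := Real.log_le_log (by norm_num) hk2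
    have h2 := Real.log_two_gt_d9
    linarith
  have unit : ∀ c : EuclideanSpace ℂ (Fin n), ‖c‖ = 1 →
      ∑ x ∈ E, ‖∑ i, (boolSign (g x i) : ℂ) * c i‖ ^ 2 ≤
        24 * (1 / k * Real.log k) * (q * 2 ^ n) := by
    intro c hc
    have hc2 := norm_sq_euclidean_eq c
    rw [hc, one_pow] at hc2
    have hre : 0 ≤ ∑ i, (c i).re ^ 2 := Finset.sum_nonneg fun i _ => sq_nonneg _
    have him : 0 ≤ ∑ i, (c i).im ^ 2 := Finset.sum_nonneg fun i _ => sq_nonneg _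
    -- This level makes the tail factor `exp (-T² / 2)` equal to `1 / k`, matching the proportion of
    -- `E`.
    set T := Real.sqrt (2 * Real.log k) with hTdef
    have hT2 : T ^ 2 = 2 * Real.log k := Real.sq_sqrt (by linarith)
    have hT : 1 ≤ T := Real.one_le_sqrt.2 (by linarith)
    have hexp : Real.exp (-T ^ 2 / 2) = 1 / k := by
      rw [hT2, show -(2 * Real.log k) / 2 = -Real.log k by ring, Real.exp_neg,
        Real.exp_log (by linarith), one_div]
    have e1 := sum_sq_rademacher_subset_le hE hg (a := fun i => (c i).re) (by linarith) hT
    have e2 := sum_sq_rademacher_subset_le hE hg (a := fun i => (c i).im) (by linarith) hT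
    simp_rw [norm_sq_sum_boolSign]
    rw [Finset.sum_add_distrib]
    rw [hexp, hT2] at e1 e2
    -- The constant is `2 * (2 + 4) = 12` for each of the two parts, hence `24` in total.
    have e3 : 2 * Real.log k * (E.card + 4 * (1 / k) * (q * 2 ^ n)) ≤
        12 * (1 / k * Real.log k) * (q * 2 ^ n) := by
      calc 2 * Real.log k * (E.card + 4 * (1 / k) * (q * 2 ^ n))
          ≤ 2 * Real.log k * (2 * (q * 2 ^ n) / k + 4 * (1 / k) * (q * 2 ^ n)) := by
            have : 0 ≤ Real.log k := by linarith
            gcongr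
        _ = _ := by ring
    linarith
  rcases eq_or_ne a 0 with rfl | ha
  · simp
  have hna : (‖a‖ : ℂ) ≠ 0 := by simpa using ha
  have h := unit ((‖a‖⁻¹ : ℂ) • a) (by rw [norm_smul]; simp [ha])
  have h2 : ∀ x, ‖∑ i, (boolSign (g x i) : ℂ) * a i‖ ^ 2 = ‖a‖ ^ 2 *
      ‖∑ i, (boolSign (g x i) : ℂ) * ((‖a‖⁻¹ : ℂ) • a) i‖ ^ 2 := by
    intro x
    rw [← mul_pow]
    congr 1
    have : ∑ i, (boolSign (g x i) : ℂ) * ((‖a‖⁻¹ : ℂ) • a) i =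
        (‖a‖⁻¹ : ℂ) * ∑ i, (boolSign (g x i) : ℂ) * a i := by
      rw [Finset.mul_sum]
      exact Finset.sum_congr rfl fun i _ => by simp; ring
    rw [this, norm_mul]
    simp [ha]
  simp_rw [h2]
  rw [← Finset.mul_sum, mul_comm]
  gcongr

/-! ### Isometric copies of `ℂⁿ` with spread-out unit vectors. -/

theorem exists_equidistributed {X : Type*} {n q : ℕ} {Z : Finset X} (hZ : q * 2 ^ n ≤ Z.card) :
    ∃ S ⊆ Z, ∃ g : X → Fin n → Bool,
      ∀ F : (Fin n → Bool) → ℝ, ∑ x ∈ S, F (g x) = q * ∑ b, F b := by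
  classical
  obtain ⟨S, hS, hcard⟩ := Finset.exists_subset_card_eq hZ
  -- A bijection with `q` copies of the cube; its second component labels each point by signs, and
  -- labels outside `S` are irrelevant.
  have e : S ≃ Fin q × (Fin n → Bool) := Fintype.equivOfCardEq (by simp [hcard])
  refine ⟨S, hS, fun x => if h : x ∈ S then (e ⟨x, h⟩).2 else fun _ => false, fun F => ?_⟩
  rw [← Finset.sum_coe_sort]
  calc ∑ x : S, F (if h : (x : X) ∈ S then (e ⟨x, h⟩).2 else fun _ => false)
      = ∑ x : S, F (e x).2 := Finset.sum_congr rfl fun x _ => by simp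
    _ = ∑ p : Fin q × (Fin n → Bool), F p.2 := Equiv.sum_comp e fun p => F p.2
    _ = _ := by rw [Fintype.sum_prod_type]; simp

theorem coordProj_apply {X : Type*} (A : Set X) [DecidablePred (· ∈ A)] (f : Ell2 X) (x : X) :
    coordProj A f x = if x ∈ A then f x else 0 := by
  have hA : coordProj A f ∈ ell2On A := Submodule.starProjection_apply_mem _ _
  have hA' : coordProj Aᶜ f ∈ ell2On Aᶜ := Submodule.starProjection_apply_mem _ _
  have h : f x = coordProj A f x + coordProj Aᶜ f x := by
    have := congrArg (fun u : BEll2 X => u f x) (coordProj_add_compl A)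
    simpa using this.symm
  split_ifs with hx
  · rw [h, hA' x (by simpa using hx), add_zero]
  · exact hA x hx

theorem norm_sq_eq_sum_of_mem_ell2On {X : Type*} {E : Finset X} {f : Ell2 X}
    (hf : f ∈ ell2On (E : Set X)) : ‖f‖ ^ 2 = ∑ x ∈ E, ‖f x‖ ^ 2 := by
  have h := lp.norm_rpow_eq_tsum (p := 2) (by norm_num) f
  simp only [ENNReal.toReal_ofNat, Real.rpow_ofNat] at h
  rw [h, tsum_eq_sum fun x hx => ?_]
  rw [hf x (by simpa using hx)]
  simp

theorem sum_norm_sq_le {X : Type*} (E : Finset X) (f : Ell2 X) :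
    ∑ x ∈ E, ‖f x‖ ^ 2 ≤ ‖f‖ ^ 2 := by
  have h := lp.sum_rpow_le_norm_rpow (p := 2) (by norm_num) f E
  simpa only [ENNReal.toReal_ofNat, Real.rpow_ofNat] using h

theorem norm_sq_coordProj {X : Type*} (E : Finset X) (f : Ell2 X) :
    ‖coordProj (E : Set X) f‖ ^ 2 = ∑ x ∈ E, ‖f x‖ ^ 2 := by
  classical
  have hmem : coordProj (E : Set X) f ∈ ell2On (E : Set X) :=
    Submodule.starProjection_apply_mem _ _
  rw [norm_sq_eq_sum_of_mem_ell2On hmem]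
  refine Finset.sum_congr rfl fun x hx => ?_
  rw [coordProj_apply, if_pos (by simpa using hx)]

/-- Allows an arbitrary set to be replaced by its trace on a finite support, where norms are finite
sums. -/
theorem coordProj_eq_of_mem_ell2On {X : Type*} {A B S : Set X} (h : A ∩ S = B ∩ S) {f : Ell2 X}
    (hf : f ∈ ell2On S) : coordProj A f = coordProj B f := by
  classical
  ext x
  rw [coordProj_apply, coordProj_apply]
  by_cases hx : x ∈ S
  · have : x ∈ A ↔ x ∈ B := by
      have := Set.ext_iff.1 h x
      simpa [hx] using this
    simp [this]
  · simp [hf x hx]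

/-- The linear map `ℂⁿ → ℓ²(X)` that sends `a` to the function `x ↦ c ∑ i, ±a i` on `S`, where the
signs at `x` are given by `g x`. -/
def rademacherMap {X : Type*} [DecidableEq X] {n : ℕ} (S : Finset X) (g : X → Fin n → Bool)
    (c : ℂ) : EuclideanSpace ℂ (Fin n) →ₗ[ℂ] Ell2 X where
  toFun a := ∑ x ∈ S, lp.single 2 x (c * ∑ i, (boolSign (g x i) : ℂ) * a i)
  map_add' a b := by
    rw [← Finset.sum_add_distrib]
    refine Finset.sum_congr rfl fun x _ => ?_
    rw [← lp.single_add]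
    congr 1
    simp [mul_add, Finset.sum_add_distrib]
  map_smul' r a := by
    rw [Finset.smul_sum]
    refine Finset.sum_congr rfl fun x _ => ?_
    rw [← lp.single_smul]
    congr 1
    simp only [PiLp.smul_apply, smul_eq_mul, RingHom.id_apply, Finset.mul_sum]
    exact Finset.sum_congr rfl fun i _ => by ring

theorem rademacherMap_apply {X : Type*} [DecidableEq X] {n : ℕ} (S : Finset X)
    (g : X → Fin n → Bool) (c : ℂ) (a : EuclideanSpace ℂ (Fin n)) (x : X) :
    rademacherMap S g c a x = if x ∈ S then c * ∑ i, (boolSign (g x i) : ℂ) * a i else 0 := by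
  change (∑ y ∈ S, lp.single 2 y (c * ∑ i, (boolSign (g y i) : ℂ) * a i) : Ell2 X) x = _
  rw [lp.coeFn_sum, Finset.sum_apply]
  simp [lp.single_apply, Pi.single_apply]

/-- If `Z` has at least `q * 2 ^ n` elements, then `ℓ²(Z)` contains an isometric copy of `ℂⁿ` whose
unit vectors carry little mass on small subsets of `Z`. -/
theorem exists_spread_isometry {X : Type*} {n q : ℕ} (hq : 0 < q) {Z : Finset X}
    (hZ : q * 2 ^ n ≤ Z.card) :
    ∃ J : EuclideanSpace ℂ (Fin n) →ₗᵢ[ℂ] Ell2 X, (∀ a, J a ∈ ell2On (Z : Set X)) ∧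
      ∀ k : ℕ, 2 ≤ k → ∀ E ⊆ Z, (E.card : ℝ) ≤ 2 * (q * 2 ^ n) / k → ∀ a,
        ‖coordProj (E : Set X) (J a)‖ ≤ Real.sqrt (24 * (1 / k * Real.log k)) * ‖a‖ := by
  classical
  obtain ⟨S, hSZ, g, hg⟩ := exists_equidistributed hZ
  have hM : (0 : ℝ) < q * 2 ^ n := by positivity
  set c : ℝ := (Real.sqrt (q * 2 ^ n))⁻¹ with hc
  have hc2 : c ^ 2 * (q * 2 ^ n) = 1 := by
    rw [hc, inv_pow, Real.sq_sqrt hM.le, inv_mul_cancel₀ hM.ne']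
  set L := rademacherMap S g (c : ℂ) with hL
  have hval : ∀ a, ∀ x ∈ S, ‖L a x‖ ^ 2 =
      c ^ 2 * ‖∑ i, (boolSign (g x i) : ℂ) * a i‖ ^ 2 := by
    intro a x hx
    rw [hL, rademacherMap_apply, if_pos hx, norm_mul, mul_pow]
    simp
  have hmem : ∀ a, L a ∈ ell2On (S : Set X) := by
    intro a x hx
    rw [hL, rademacherMap_apply, if_neg (by simpa using hx)]
  have hnorm : ∀ a, ‖L a‖ = ‖a‖ := by
    intro a
    rw [← sq_eq_sq₀ (norm_nonneg _) (norm_nonneg _), norm_sq_eq_sum_of_mem_ell2On (hmem a),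
      Finset.sum_congr rfl (hval a), ← Finset.mul_sum, sum_norm_sq_rademacher hg, ← mul_assoc, hc2,
      one_mul]
  refine ⟨⟨L, hnorm⟩, fun a x hx => hmem a x fun h => hx (hSZ h), fun k hk E _ hcard a => ?_⟩
  have hk2 : (2 : ℝ) ≤ k := by exact_mod_cast hk
  have hlog : 0 ≤ Real.log k := Real.log_nonneg (by linarith)
  refine le_of_sq_le_sq ?_ (by positivity)
  rw [mul_pow, Real.sq_sqrt (by positivity)]
  change ‖coordProj (E : Set X) (L a)‖ ^ 2 ≤ _
  have hcard' : ((E ∩ S).card : ℝ) ≤ 2 * (q * 2 ^ n) / k :=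
    le_trans (by exact_mod_cast Finset.card_le_card Finset.inter_subset_left) hcard
  rw [coordProj_eq_of_mem_ell2On (B := ((E ∩ S : Finset X) : Set X)) (S := (S : Set X))
    (by simp [Set.inter_assoc]) (hmem a), norm_sq_coordProj,
    Finset.sum_congr rfl fun x hx => hval a x (Finset.mem_of_mem_inter_right hx), ← Finset.mul_sum]
  calc _ ≤ c ^ 2 * (24 * (1 / k * Real.log k) * (q * 2 ^ n) * ‖a‖ ^ 2) := by
        gcongr
        exact sum_norm_sq_rademacher_subset_le Finset.inter_subset_right hg hk hcard' a
    _ = c ^ 2 * (q * 2 ^ n) * (24 * (1 / k * Real.log k) * ‖a‖ ^ 2) := by ring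
    _ = _ := by rw [hc2, one_mul]

/-! ### Passing to disjoint pieces. -/

/-- Along a subsequence, finite sets whose cardinalities tend to infinity contain mutually disjoint
subsets of at least half their size. -/
theorem exists_disjoint_subsequence {X : Type*} (Y : ℕ → Finset X)
    (hY : Filter.Tendsto (fun n => (Y n).card) Filter.atTop Filter.atTop) :
    ∃ (m : ℕ → ℕ) (Z : ℕ → Finset X) (q : ℕ → ℕ), StrictMono m ∧ (∀ n, Z n ⊆ Y (m n)) ∧
      (Pairwise fun i j => Disjoint (Z i) (Z j)) ∧ (∀ n, 0 < q n) ∧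
      (∀ n, q n * 2 ^ n ≤ (Z n).card) ∧ ∀ n, (Y (m n)).card ≤ 2 * (q n * 2 ^ n) := by
  classical
  let U : ℕ → Finset X := fun M => (Finset.range M).biUnion Y
  -- The factor `2` leaves at least half of `Y l` after losing the points of `U M` and fewer than `2
  -- ^ n` more by rounding.
  have ex : ∀ n M : ℕ, ∃ l, M ≤ l ∧ 2 * ((U M).card + 2 ^ n) ≤ (Y l).card := fun n M =>
    ((Filter.eventually_ge_atTop M).and (hY.eventually_ge_atTop _)).exists
  choose next hle hcard using ex
  let m : ℕ → ℕ := fun n => Nat.rec (next 0 0) (fun n l => next (n + 1) (l + 1)) n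
  -- `U (b n)` is the union of all `Y l` with `l ≤ m (n - 1)`, and is empty for `n = 0`.
  let b : ℕ → ℕ := fun n => Nat.casesOn n 0 fun n => m n + 1
  have hmb : ∀ n, m n = next n (b n) := by rintro (_ | n) <;> rfl
  have hm : StrictMono m := strictMono_nat_of_lt_succ fun n =>
    Nat.lt_of_succ_le (hle (n + 1) (m n + 1))
  have hlt : ∀ i j, i < j → m i < b j := by
    rintro i (_ | j) hij
    · omega
    · exact Nat.lt_succ_of_le (hm.monotone (by omega))
  let Z : ℕ → Finset X := fun n => Y (m n) \ U (b n)
  have hdisj : ∀ i j, i < j → Disjoint (Z i) (Z j) := by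
    intro i j hij
    refine Finset.disjoint_left.2 fun x hi hj => (Finset.mem_sdiff.1 hj).2 ?_
    exact Finset.mem_biUnion.2 ⟨m i, Finset.mem_range.2 (hlt i j hij), (Finset.mem_sdiff.1 hi).1⟩
  have hc : ∀ n, 2 * ((U (b n)).card + 2 ^ n) ≤ (Y (m n)).card := fun n => hmb n ▸ hcard n (b n)
  have hZ : ∀ n, (Y (m n)).card ≤ (Z n).card + (U (b n)).card := fun n => by
    have := Finset.le_card_sdiff (U (b n)) (Y (m n))
    simp only [Z]
    omega
  have hq : ∀ n, (Z n).card < (Z n).card / 2 ^ n * 2 ^ n + 2 ^ n := fun n =>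
    Nat.lt_div_mul_add (by positivity)
  refine ⟨m, Z, fun n => (Z n).card / 2 ^ n, hm, fun n => Finset.sdiff_subset, ?_, fun n => ?_,
    fun n => Nat.div_mul_le_self _ _, fun n => ?_⟩
  · intro i j hij
    rcases hij.lt_or_gt with h | h
    · exact hdisj i j h
    · exact (hdisj j i h).symm
  · have h1 := hc n
    have h2 := hZ n
    have h3 : 0 < 2 ^ n := by positivity
    exact Nat.div_pos (by omega) h3
  · have h1 := hc n
    have h2 := hZ n
    have h3 := hq n
    dsimp only
    omega

/-! ### Expansion and distant sets. -/

section Expander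

variable {X : Type*} [MetricSpace X]

/-- In an expander, a set with more than `N / k` elements has a large neighbourhood. -/
theorem expander_growth {Y : Finset X} {R κ : ℝ} (hκ : 1 < κ)
    (hY : ∀ A ⊆ Y, A.Nonempty → (A.card : ℝ) / (Y.card : ℝ) ≤ 1 / 2 →
      κ ≤ ({x ∈ (Y : Set X) | Metric.infDist x (A : Set X) ≤ R}.ncard : ℝ) / (A.card : ℝ))
    (hR : 0 < R) {A : Finset X} (hA : A ⊆ Y) (hne : A.Nonempty) (j : ℕ) :
    ∃ B ⊆ Y, B.Nonempty ∧ (∀ x ∈ B, ∃ a ∈ A, dist x a ≤ j * R) ∧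
      ((Y.card : ℝ) < 2 * B.card ∨ κ ^ j * A.card ≤ B.card) := by
  classical
  induction j with
  | zero => exact ⟨A, hA, hne, fun x hx => ⟨x, hx, by simp⟩, Or.inr (by simp)⟩
  | succ j ih =>
    obtain ⟨B, hB, hBne, hd, h⟩ := ih
    -- Expansion is available only up to half of `Y`; once `B` exceeds that it is kept, otherwise it
    -- is replaced by its `R`-neighbourhood.
    rcases lt_or_ge (Y.card : ℝ) (2 * B.card) with hlt | hge
    · refine ⟨B, hB, hBne, fun x hx => ?_, Or.inl hlt⟩
      obtain ⟨a, ha, hxa⟩ := hd x hx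
      refine ⟨a, ha, hxa.trans ?_⟩
      push_cast
      nlinarith
    · have hBpos : (0 : ℝ) < B.card := by exact_mod_cast hBne.card_pos
      have hYpos : (0 : ℝ) < Y.card := by
        exact_mod_cast (hBne.mono hB).card_pos
      have hcard := h.resolve_left (not_lt.2 hge)
      have hexp := hY B hB hBne (by rw [div_le_div_iff₀ hYpos two_pos]; linarith)
      rw [le_div_iff₀ hBpos] at hexp
      have hC : {x ∈ (Y : Set X) | Metric.infDist x (B : Set X) ≤ R} =
          (({x ∈ Y | Metric.infDist x (B : Set X) ≤ R} : Finset X) : Set X) := by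
        ext x; simp
      rw [hC, Set.ncard_coe_finset] at hexp
      refine ⟨{x ∈ Y | Metric.infDist x (B : Set X) ≤ R}, Finset.filter_subset _ _, ?_, ?_,
        Or.inr ?_⟩
      · rw [← Finset.card_pos]
        have : 0 < κ * B.card := by nlinarith
        exact_mod_cast this.trans_le hexp
      · intro x hx
        have hx2 := (Finset.mem_filter.1 hx).2
        obtain ⟨y, hy, hxy⟩ := B.finite_toSet.isCompact.exists_infDist_eq_dist hBne x
        obtain ⟨a, ha, hya⟩ := hd y hy
        refine ⟨a, ha, ?_⟩
        have := dist_triangle x y a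
        push_cast
        linarith
      · refine le_trans ?_ hexp
        rw [pow_succ]
        have := mul_le_mul_of_nonneg_left hcard (by linarith : 0 ≤ κ)
        linarith

/-- Two sets that are far apart cannot both occupy a fixed proportion of an expander. -/
theorem IsExpanderSequence.exists_dist {Y : ℕ → Finset X} (hY : IsExpanderSequence Y) {k : ℕ}
    (hk : 0 < k) :
    ∃ D : ℝ, 0 < D ∧ ∀ n, ∀ A ⊆ Y n, ∀ B ⊆ Y n, (∀ a ∈ A, ∀ b ∈ B, D < dist a b) →
      (A.card : ℝ) ≤ (Y n).card / k ∨ (B.card : ℝ) ≤ (Y n).card / k := by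
  classical
  obtain ⟨-, R, hR, κ, hκ, h⟩ := hY
  obtain ⟨j, hj⟩ := pow_unbounded_of_one_lt (k : ℝ) hκ
  have hkpos : (0 : ℝ) < k := by exact_mod_cast hk
  -- Two sets of proportion above `1/k` grow within distance `j * R` to more than half of `Y n`
  -- each, so their neighbourhoods meet and the sets are within `2 * j * R`.
  refine ⟨2 * j * R + 1, by positivity, fun n A hA B hB hAB => ?_⟩
  by_contra! hcon
  have big : ∀ C ⊆ Y n, ((Y n).card : ℝ) / k < C.card → ∃ C' ⊆ Y n,
      (∀ x ∈ C', ∃ c ∈ C, dist x c ≤ j * R) ∧ ((Y n).card : ℝ) < 2 * C'.card := by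
    intro C hC hcard
    have hpos : (0 : ℝ) < C.card := lt_of_le_of_lt (by positivity) hcard
    obtain ⟨C', hC', -, hd, h'⟩ := expander_growth hκ (h n) hR hC
      (Finset.card_pos.1 (by exact_mod_cast hpos)) j
    refine ⟨C', hC', hd, ?_⟩
    rw [div_lt_iff₀ hkpos] at hcard
    rcases h' with h' | h'
    · exact h'
    · have hle : (C'.card : ℝ) ≤ (Y n).card := by exact_mod_cast Finset.card_le_card hC'
      have : C.card * (k : ℝ) < C.card * κ ^ j := by gcongr
      linarith
  obtain ⟨A', hA', hdA, hcA⟩ := big A hA hcon.1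
  obtain ⟨B', hB', hdB, hcB⟩ := big B hB hcon.2
  have hinter : (A' ∩ B').Nonempty := by
    rw [Finset.nonempty_iff_ne_empty]
    intro he
    have h1 := Finset.card_union_add_card_inter A' B'
    have h2 := Finset.card_le_card (Finset.union_subset hA' hB')
    rw [he, Finset.card_empty, add_zero] at h1
    have h3 : (A'.card : ℝ) + B'.card ≤ (Y n).card := by exact_mod_cast h1 ▸ h2
    linarith
  obtain ⟨x, hx⟩ := hinter
  obtain ⟨a, ha, hxa⟩ := hdA x (Finset.mem_inter.1 hx).1
  obtain ⟨b, hb, hxb⟩ := hdB x (Finset.mem_inter.1 hx).2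
  have h1 := hAB a ha b hb
  have h2 := dist_triangle_left a b x
  linarith

end Expander

/-! ### Block diagonal operators on an orthogonal family. -/

/-- The Hilbert space direct sum `⨁_n ℂⁿ`. -/
abbrev EuclideanSum : Type := lp (fun n : ℕ => EuclideanSpace ℂ (Fin n)) 2

theorem norm_toEuclideanCLM_apply_le (a : MatrixProduct) (n : ℕ) (v : EuclideanSpace ℂ (Fin n)) :
    ‖Matrix.toEuclideanCLM (n := Fin n) (𝕜 := ℂ) (a n) v‖ ≤ ‖a‖ * ‖v‖ := by
  refine (ContinuousLinearMap.le_opNorm _ _).trans ?_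
  rw [Matrix.l2_opNorm_toEuclideanCLM]
  gcongr
  exact lp.norm_apply_le_norm ENNReal.top_ne_zero a n

/-- The diagonal action of `∏_n M_n` on `⨁_n ℂⁿ`. -/
def diagonalAction (a : MatrixProduct) : EuclideanSum →L[ℂ] EuclideanSum :=
  LinearMap.mkContinuous
    { toFun := fun f => ⟨fun n => Matrix.toEuclideanCLM (n := Fin n) (𝕜 := ℂ) (a n) (f n),
        ((lp.memℓp f).norm.const_mul ‖a‖).mono fun n => by
          simpa using norm_toEuclideanCLM_apply_le a n (f n)⟩
      map_add' := fun f g => by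
        ext1; funext n
        exact map_add (Matrix.toEuclideanCLM (n := Fin n) (𝕜 := ℂ) (a n)) (f n) (g n)
      map_smul' := fun c f => by
        ext1; funext n
        exact map_smul (Matrix.toEuclideanCLM (n := Fin n) (𝕜 := ℂ) (a n)) c (f n) }
    ‖a‖ fun f => by
      refine lp.norm_le_of_forall_sum_le (by norm_num) (by positivity) fun s => ?_
      calc _ ≤ ∑ n ∈ s, ‖a‖ ^ (2 : ℝ) * ‖f n‖ ^ (2 : ℝ) := by
            refine Finset.sum_le_sum fun n _ => ?_
            simp only [ENNReal.toReal_ofNat]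
            rw [← Real.mul_rpow (norm_nonneg _) (norm_nonneg _)]
            exact Real.rpow_le_rpow (norm_nonneg _) (norm_toEuclideanCLM_apply_le a n (f n))
              (by norm_num)
        _ ≤ ‖a‖ ^ (2 : ℝ) * ‖f‖ ^ (2 : ℝ) := by
            rw [← Finset.mul_sum]
            gcongr
            simpa using lp.sum_rpow_le_norm_rpow (p := 2) (by norm_num) f s
        _ = _ := by
            rw [← Real.mul_rpow (norm_nonneg _) (norm_nonneg _)]
            simp

theorem diagonalAction_apply (a : MatrixProduct) (f : EuclideanSum) (n : ℕ) :
    diagonalAction a f n = Matrix.toEuclideanCLM (n := Fin n) (𝕜 := ℂ) (a n) (f n) := rfl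

theorem diagonalAction_ext {T : EuclideanSum →L[ℂ] EuclideanSum} {a : MatrixProduct}
    (h : ∀ f n, T f n = Matrix.toEuclideanCLM (n := Fin n) (𝕜 := ℂ) (a n) (f n)) :
    diagonalAction a = T := by
  ext f : 1
  ext1; funext n
  exact (h f n).symm

theorem diagonalAction_add (a b : MatrixProduct) :
    diagonalAction (a + b) = diagonalAction a + diagonalAction b :=
  diagonalAction_ext fun f n => by
    change diagonalAction a f n + diagonalAction b f n = _
    rw [diagonalAction_apply, diagonalAction_apply, lp.coeFn_add, Pi.add_apply, map_add]
    rfl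

theorem diagonalAction_smul (c : ℂ) (a : MatrixProduct) :
    diagonalAction (c • a) = c • diagonalAction a :=
  diagonalAction_ext fun f n => by
    change c • diagonalAction a f n = _
    rw [diagonalAction_apply, lp.coeFn_smul, Pi.smul_apply, map_smul]
    rfl

theorem diagonalAction_mul (a b : MatrixProduct) :
    diagonalAction (a * b) = diagonalAction a * diagonalAction b :=
  diagonalAction_ext fun f n => by
    change diagonalAction a (diagonalAction b f) n = _
    rw [diagonalAction_apply, diagonalAction_apply, lp.infty_coeFn_mul, Pi.mul_apply, map_mul]
    rfl

theorem diagonalAction_star (a : MatrixProduct) :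
    diagonalAction (star a) = star (diagonalAction a) := by
  rw [ContinuousLinearMap.star_eq_adjoint, ContinuousLinearMap.eq_adjoint_iff]
  intro f g
  rw [lp.inner_eq_tsum, lp.inner_eq_tsum]
  refine tsum_congr fun n => ?_
  rw [diagonalAction_apply, diagonalAction_apply, lp.star_apply, map_star,
    ContinuousLinearMap.star_eq_adjoint, ContinuousLinearMap.adjoint_inner_left]

section Block

variable {H : Type*} [NormedAddCommGroup H] [InnerProductSpace ℂ H] [CompleteSpace H]
  {J : ∀ n, EuclideanSpace ℂ (Fin n) →ₗᵢ[ℂ] H}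

/-- The inclusion of the Hilbert space direct sum of an orthogonal family. -/
def sumInclusion (hJ : OrthogonalFamily ℂ (fun n => EuclideanSpace ℂ (Fin n)) J) :
    EuclideanSum →L[ℂ] H :=
  hJ.linearIsometry.toContinuousLinearMap

variable (hJ : OrthogonalFamily ℂ (fun n => EuclideanSpace ℂ (Fin n)) J)

theorem adjoint_sumInclusion_mul :
    (ContinuousLinearMap.adjoint (sumInclusion hJ)).comp (sumInclusion hJ) =
      ContinuousLinearMap.id ℂ _ :=
  (ContinuousLinearMap.norm_map_iff_adjoint_comp_self _).1 hJ.linearIsometry.norm_map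

theorem adjoint_sumInclusion_sumInclusion (f : EuclideanSum) :
    ContinuousLinearMap.adjoint (sumInclusion hJ) (sumInclusion hJ f) = f :=
  DFunLike.congr_fun (adjoint_sumInclusion_mul hJ) f

theorem adjoint_sumInclusion_apply (h : H) (n : ℕ) :
    ContinuousLinearMap.adjoint (sumInclusion hJ) h n =
      ContinuousLinearMap.adjoint (J n).toContinuousLinearMap h := by
  refine ext_inner_left ℂ fun v => ?_
  refine (lp.inner_single_left (𝕜 := ℂ) (G := fun n => EuclideanSpace ℂ (Fin n)) n v _).symm.trans
    ?_
  rw [ContinuousLinearMap.adjoint_inner_right, ContinuousLinearMap.adjoint_inner_right]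
  congr 1
  exact hJ.linearIsometry_apply_single v

theorem sumInclusion_single (n : ℕ) (v : EuclideanSpace ℂ (Fin n)) :
    sumInclusion hJ (lp.single 2 n v) = J n v :=
  hJ.linearIsometry_apply_single v

/-- The operator on `H` that acts as the `n`-th matrix on the `n`-th summand of an orthogonal
family and vanishes on its orthogonal complement. -/
def blockOperator (a : MatrixProduct) : H →L[ℂ] H :=
  (sumInclusion hJ).comp ((diagonalAction a).comp (ContinuousLinearMap.adjoint (sumInclusion hJ)))

theorem blockOperator_apply (a : MatrixProduct) (h : H) :
    blockOperator hJ a h =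
      sumInclusion hJ (diagonalAction a (ContinuousLinearMap.adjoint (sumInclusion hJ) h)) := rfl

theorem blockOperator_add (a b : MatrixProduct) :
    blockOperator hJ (a + b) = blockOperator hJ a + blockOperator hJ b := by
  ext h
  simp [blockOperator_apply, diagonalAction_add]

theorem blockOperator_smul (c : ℂ) (a : MatrixProduct) :
    blockOperator hJ (c • a) = c • blockOperator hJ a := by
  ext h
  simp [blockOperator_apply, diagonalAction_smul]

theorem blockOperator_mul (a b : MatrixProduct) :
    blockOperator hJ (a * b) = blockOperator hJ a * blockOperator hJ b := by
  ext h
  simp [blockOperator_apply, diagonalAction_mul, adjoint_sumInclusion_sumInclusion]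

theorem blockOperator_star (a : MatrixProduct) :
    blockOperator hJ (star a) = star (blockOperator hJ a) := by
  rw [blockOperator, blockOperator, diagonalAction_star]
  simp only [ContinuousLinearMap.star_eq_adjoint, ContinuousLinearMap.adjoint_comp,
    ContinuousLinearMap.adjoint_adjoint, ContinuousLinearMap.comp_assoc]

theorem blockOperator_map (a : MatrixProduct) (n : ℕ) (v : EuclideanSpace ℂ (Fin n)) :
    blockOperator hJ a (J n v) = J n (Matrix.toEuclideanCLM (n := Fin n) (𝕜 := ℂ) (a n) v) := by
  rw [blockOperator_apply, ← sumInclusion_single hJ, adjoint_sumInclusion_sumInclusion,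
    ← sumInclusion_single hJ]
  congr 1
  ext1; funext l
  rw [diagonalAction_apply, lp.coeFn_single, lp.coeFn_single]
  rcases eq_or_ne l n with rfl | hl
  · rw [Pi.single_eq_same, Pi.single_eq_same]
  · rw [Pi.single_eq_of_ne hl, Pi.single_eq_of_ne hl, map_zero]

theorem blockOperator_injective : Function.Injective (blockOperator hJ) := by
  intro a b hab
  ext1; funext n
  have h : ∀ v, Matrix.toEuclideanCLM (n := Fin n) (𝕜 := ℂ) (a n) v =
      Matrix.toEuclideanCLM (n := Fin n) (𝕜 := ℂ) (b n) v := fun v =>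
    (J n).injective (by rw [← blockOperator_map hJ, ← blockOperator_map hJ, hab])
  exact (Matrix.toEuclideanCLM (n := Fin n) (𝕜 := ℂ)).injective (ContinuousLinearMap.ext h)

theorem adjoint_sumInclusion_eq_zero {w : H}
    (hw : w ∈ (⨆ n, LinearMap.range (J n).toLinearMap)ᗮ) :
    ContinuousLinearMap.adjoint (sumInclusion hJ) w = 0 := by
  ext1; funext n
  rw [adjoint_sumInclusion_apply]
  refine ext_inner_left ℂ fun v => ?_
  rw [ContinuousLinearMap.adjoint_inner_right]
  change _ = ⟪v, (0 : EuclideanSpace ℂ (Fin n))⟫_ℂ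
  rw [inner_zero_right]
  exact (Submodule.mem_orthogonal _ _).1 hw _
    (Submodule.mem_iSup_of_mem n (LinearMap.mem_range_self (J n).toLinearMap v))

/-- A block diagonal `u` is recovered from its compressions `T n = (J n)* u (J n)`, which form a
bounded sequence. Both operators agree on each summand, hence on the closed span, and vanish on its
complement. -/
theorem range_blockOperator :
    Set.range (blockOperator hJ) =
      blockDiagonalOperators fun n => LinearMap.range (J n).toLinearMap := by
  refine Set.Subset.antisymm ?_ ?_
  · rintro _ ⟨a, rfl⟩
    refine ⟨?_, fun w hw => ?_⟩
    · rintro n _ ⟨v, rfl⟩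
      exact ⟨_, (blockOperator_map hJ a n v).symm⟩
    · rw [blockOperator_apply, adjoint_sumInclusion_eq_zero hJ hw, map_zero, map_zero]
  · rintro u ⟨hu, hu0⟩
    let T : ∀ n, EuclideanSpace ℂ (Fin n) →L[ℂ] EuclideanSpace ℂ (Fin n) := fun n =>
      (ContinuousLinearMap.adjoint (J n).toContinuousLinearMap).comp
        (u.comp (J n).toContinuousLinearMap)
    have hadj : ∀ n v, ContinuousLinearMap.adjoint (J n).toContinuousLinearMap (J n v) = v :=
      fun n v => DFunLike.congr_fun
        ((ContinuousLinearMap.norm_map_iff_adjoint_comp_self _).1 (J n).norm_map) v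
    have hT : ∀ n v, J n (T n v) = u (J n v) := by
      intro n v
      obtain ⟨w, hw⟩ := hu n (J n v) ⟨v, rfl⟩
      change J n (ContinuousLinearMap.adjoint (J n).toContinuousLinearMap (u (J n v))) = _
      have hw' : J n w = u (J n v) := hw
      rw [← hw', hadj]
    have hTnorm : ∀ n, ‖T n‖ ≤ ‖u‖ := fun n =>
      ContinuousLinearMap.opNorm_le_bound _ (norm_nonneg _) fun v => by
        rw [← (J n).norm_map, hT, ← (J n).norm_map v]
        exact u.le_opNorm _
    let a : MatrixProduct :=
      ⟨fun n => (Matrix.toEuclideanCLM (n := Fin n) (𝕜 := ℂ)).symm (T n), memℓp_infty ⟨‖u‖, by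
        rintro _ ⟨n, rfl⟩
        change ‖_‖ ≤ _
        rw [Matrix.cstar_norm_def, StarAlgEquiv.apply_symm_apply]
        exact hTnorm n⟩⟩
    have ha : ∀ n, Matrix.toEuclideanCLM (n := Fin n) (𝕜 := ℂ) (a n) = T n := fun n =>
      StarAlgEquiv.apply_symm_apply _ _
    refine ⟨a, ?_⟩
    set K := (⨆ n, LinearMap.range (J n).toLinearMap).topologicalClosure with hK
    have hKo : Kᗮ = (⨆ n, LinearMap.range (J n).toLinearMap)ᗮ :=
      Submodule.orthogonal_closure _
    have : CompleteSpace K :=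
      (Submodule.isClosed_topologicalClosure _).completeSpace_coe
    have hEq : ∀ v ∈ K, blockOperator hJ a v = u v := by
      have hclosed : IsClosed ((LinearMap.eqLocus (blockOperator hJ a).toLinearMap u.toLinearMap :
          Submodule ℂ H) : Set H) :=
        isClosed_eq (blockOperator hJ a).continuous u.continuous
      intro v hv
      refine Submodule.topologicalClosure_minimal _ ?_ hclosed hv
      refine iSup_le fun n => ?_
      rintro _ ⟨w, rfl⟩
      change blockOperator hJ a (J n w) = u (J n w)
      rw [blockOperator_map, ha, hT]
    ext1 h
    obtain ⟨y, hy, z, hz, rfl⟩ := K.exists_add_mem_mem_orthogonal h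
    rw [hKo] at hz
    rw [map_add, map_add, hEq y hy, hu0 z hz, blockOperator_apply,
      adjoint_sumInclusion_eq_zero hJ hz, map_zero, map_zero]

end Block

/-! ### From spread-out blocks to small compressions. -/

section Spread

variable {X : Type*} {G : Type*} [NormedAddCommGroup G] [InnerProductSpace ℂ G]

theorem inner_coordProj_left (A : Set X) (f g : Ell2 X) :
    ⟪coordProj A f, g⟫_ℂ = ⟪f, coordProj A g⟫_ℂ := by
  rw [← ContinuousLinearMap.adjoint_inner_right, ← ContinuousLinearMap.star_eq_adjoint,
    star_coordProj]

theorem coordProj_eq_self {A : Set X} {f : Ell2 X} (hf : f ∈ ell2On A) : coordProj A f = f :=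
  Submodule.starProjection_eq_self_iff.2 hf

theorem coordProj_mem_of_mem {A S : Set X} {f : Ell2 X} (hf : f ∈ ell2On S) :
    coordProj A f ∈ ell2On S := by
  classical
  intro x hx
  rw [coordProj_apply, hf x hx, ite_self]

/-- With `w = J* 1_A f`, one has `‖w‖² = ⟪1_A J w, 1_S f⟫`, because `1_A J w` is still supported in
`S`. Having `1_S f` in place of `f` makes these bounds square summable over disjoint blocks. -/
theorem norm_adjoint_coordProj_le [CompleteSpace G] {J : G →ₗᵢ[ℂ] Ell2 X} {S A : Set X}
    (hJ : ∀ c, J c ∈ ell2On S) {α : ℝ} (hα : 0 ≤ α)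
    (h : ∀ c, ‖coordProj A (J c)‖ ≤ α * ‖c‖) (f : Ell2 X) :
    ‖ContinuousLinearMap.adjoint J.toContinuousLinearMap (coordProj A f)‖ ≤
      α * ‖coordProj S f‖ := by
  set w := ContinuousLinearMap.adjoint J.toContinuousLinearMap (coordProj A f) with hw
  have key : ⟪w, w⟫_ℂ = ⟪coordProj A (J w), coordProj S f⟫_ℂ := by
    rw [← inner_coordProj_left, coordProj_eq_self (coordProj_mem_of_mem (hJ w)),
      inner_coordProj_left]
    nth_rw 2 [hw]
    rw [ContinuousLinearMap.adjoint_inner_right]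
    rfl
  have h1 : ‖w‖ * ‖w‖ ≤ ‖w‖ * (α * ‖coordProj S f‖) := by
    rw [← inner_self_eq_norm_mul_norm (𝕜 := ℂ), key]
    calc _ ≤ ‖coordProj A (J w)‖ * ‖coordProj S f‖ := re_inner_le_norm _ _
      _ ≤ α * ‖w‖ * ‖coordProj S f‖ := by gcongr; exact h w
      _ = _ := by ring
  rcases (norm_nonneg w).eq_or_lt with h0 | h0
  · rw [← h0]; positivity
  · exact le_of_mul_le_mul_left h1 h0

/-- Taking adjoints turns `P 1_A` into `1_A P`, and every `P f` is `J c` with `‖c‖ ≤ ‖f‖`. -/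
theorem norm_starProjection_range_mul_coordProj_le {J : G →ₗᵢ[ℂ] Ell2 X}
    [(LinearMap.range J.toLinearMap).HasOrthogonalProjection] {A : Set X} {α : ℝ} (hα : 0 ≤ α)
    (h : ∀ c, ‖coordProj A (J c)‖ ≤ α * ‖c‖) :
    ‖(LinearMap.range J.toLinearMap).starProjection * coordProj A‖ ≤ α := by
  rw [← norm_star, star_mul, star_coordProj,
    (isSelfAdjoint_starProjection (LinearMap.range J.toLinearMap)).star_eq]
  refine ContinuousLinearMap.opNorm_le_bound _ hα fun f => ?_
  obtain ⟨c, hc⟩ := Submodule.starProjection_apply_mem (LinearMap.range J.toLinearMap) f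
  have hc' : J c = (LinearMap.range J.toLinearMap).starProjection f := hc
  change ‖coordProj A ((LinearMap.range J.toLinearMap).starProjection f)‖ ≤ _
  rw [← hc']
  refine (h c).trans ?_
  gcongr
  rw [← J.norm_map, hc']
  exact Submodule.norm_starProjection_apply_le _ f

theorem sum_norm_sq_coordProj_le {Z : ℕ → Finset X}
    (hZ : Pairwise fun i j => Disjoint (Z i) (Z j)) (s : Finset ℕ) (f : Ell2 X) :
    ∑ n ∈ s, ‖coordProj (Z n : Set X) f‖ ^ 2 ≤ ‖f‖ ^ 2 := by
  classical
  simp_rw [norm_sq_coordProj]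
  rw [← Finset.sum_biUnion fun i _ j _ hij => hZ hij]
  exact sum_norm_sq_le _ f

theorem orthogonalFamily_of_disjoint {G : ℕ → Type*} [∀ n, NormedAddCommGroup (G n)]
    [∀ n, InnerProductSpace ℂ (G n)] {Z : ℕ → Finset X}
    (hZ : Pairwise fun i j => Disjoint (Z i) (Z j)) {J : ∀ n, G n →ₗᵢ[ℂ] Ell2 X}
    (hJ : ∀ n c, J n c ∈ ell2On (Z n : Set X)) : OrthogonalFamily ℂ G J := by
  intro i j hij v w
  rw [lp.inner_eq_tsum]
  have h0 : ∀ x, ⟪J i v x, J j w x⟫_ℂ = 0 := by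
    intro x
    by_cases hx : x ∈ Z i
    · rw [hJ j w x (by simpa using Finset.disjoint_left.1 (hZ hij) hx), inner_zero_right]
    · rw [hJ i v x (by simpa using hx), inner_zero_left]
  rw [tsum_congr h0, tsum_zero]

/-- If on each block one of `A`, `B` carries little mass, then the compression `1_A u 1_B` of a block
diagonal operator `u` is small. -/
theorem norm_coordProj_blockOperator_le {Z : ℕ → Finset X}
    (hZ : Pairwise fun i j => Disjoint (Z i) (Z j))
    {J : ∀ n, EuclideanSpace ℂ (Fin n) →ₗᵢ[ℂ] Ell2 X}
    (hJZ : ∀ n c, J n c ∈ ell2On (Z n : Set X))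
    (hJ : OrthogonalFamily ℂ (fun n => EuclideanSpace ℂ (Fin n)) J) (a : MatrixProduct)
    {A B : Set X} {δ : ℝ} (hδ : 0 ≤ δ)
    (h : ∀ n, (∀ c, ‖coordProj A (J n c)‖ ≤ δ * ‖c‖) ∨ ∀ c, ‖coordProj B (J n c)‖ ≤ δ * ‖c‖) :
    ‖coordProj A * blockOperator hJ a * coordProj B‖ ≤ δ * ‖a‖ := by
  have triv : ∀ (C : Set X) n c, ‖coordProj C (J n c)‖ ≤ 1 * ‖c‖ := fun C n c => by
    rw [← (J n).norm_map c]
    exact (coordProj C).le_of_opNorm_le (norm_coordProj_le C) _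
  have hprod : ∀ n (g f : Ell2 X),
      ‖ContinuousLinearMap.adjoint (J n).toContinuousLinearMap (coordProj A g)‖ *
        ‖ContinuousLinearMap.adjoint (J n).toContinuousLinearMap (coordProj B f)‖ ≤
      δ * (‖coordProj (Z n : Set X) g‖ * ‖coordProj (Z n : Set X) f‖) := by
    intro n g f
    rcases h n with h | h
    · have e1 := norm_adjoint_coordProj_le (hJZ n) hδ h g
      have e2 := norm_adjoint_coordProj_le (hJZ n) zero_le_one (triv B n) f
      calc _ ≤ (δ * ‖coordProj (Z n : Set X) g‖) * (1 * ‖coordProj (Z n : Set X) f‖) := by gcongr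
        _ = _ := by ring
    · have e1 := norm_adjoint_coordProj_le (hJZ n) zero_le_one (triv A n) g
      have e2 := norm_adjoint_coordProj_le (hJZ n) hδ h f
      calc _ ≤ (1 * ‖coordProj (Z n : Set X) g‖) * (δ * ‖coordProj (Z n : Set X) f‖) := by gcongr
        _ = _ := by ring
  have bilin : ∀ g f : Ell2 X, ‖⟪g, (coordProj A * blockOperator hJ a * coordProj B) f⟫_ℂ‖ ≤
      δ * ‖a‖ * (‖g‖ * ‖f‖) := by
    intro g f
    have e1 : ⟪g, (coordProj A * blockOperator hJ a * coordProj B) f⟫_ℂ =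
        ⟪ContinuousLinearMap.adjoint (sumInclusion hJ) (coordProj A g),
          diagonalAction a (ContinuousLinearMap.adjoint (sumInclusion hJ) (coordProj B f))⟫_ℂ := by
      rw [ContinuousLinearMap.adjoint_inner_left, inner_coordProj_left]
      rfl
    rw [e1]
    have hsum : Filter.Tendsto _ _ (nhds _) := lp.hasSum_inner (𝕜 := ℂ)
      (ContinuousLinearMap.adjoint (sumInclusion hJ) (coordProj A g))
      (diagonalAction a (ContinuousLinearMap.adjoint (sumInclusion hJ) (coordProj B f)))
    refine le_of_tendsto hsum.norm (Filter.Eventually.of_forall fun s => ?_)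
    refine (norm_sum_le _ _).trans ?_
    calc _ ≤ ∑ n ∈ s, δ * ‖a‖ * (‖coordProj (Z n : Set X) g‖ * ‖coordProj (Z n : Set X) f‖) := by
          refine Finset.sum_le_sum fun n _ => (norm_inner_le_norm _ _).trans ?_
          rw [diagonalAction_apply, adjoint_sumInclusion_apply, adjoint_sumInclusion_apply]
          refine (mul_le_mul_of_nonneg_left (norm_toEuclideanCLM_apply_le a n _)
            (norm_nonneg _)).trans ?_
          have := mul_le_mul_of_nonneg_left (hprod n g f) (norm_nonneg a)
          linarith
      _ = δ * ‖a‖ * ∑ n ∈ s, ‖coordProj (Z n : Set X) g‖ * ‖coordProj (Z n : Set X) f‖ := by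
          rw [Finset.mul_sum]
      _ ≤ δ * ‖a‖ * (√(‖g‖ ^ 2) * √(‖f‖ ^ 2)) := by
          gcongr
          refine (Real.sum_mul_le_sqrt_mul_sqrt s _ _).trans ?_
          gcongr
          · exact sum_norm_sq_coordProj_le hZ s g
          · exact sum_norm_sq_coordProj_le hZ s f
      _ = _ := by rw [Real.sqrt_sq (norm_nonneg _), Real.sqrt_sq (norm_nonneg _)]
  refine ContinuousLinearMap.opNorm_le_bound _ (by positivity) fun f => ?_
  -- Testing the form against the image vector itself turns the bilinear bound into an operator norm
  -- bound.
  have hb := bilin ((coordProj A * blockOperator hJ a * coordProj B) f) f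
  set y := (coordProj A * blockOperator hJ a * coordProj B) f with hy
  have h1 : ‖y‖ * ‖y‖ ≤ ‖y‖ * (δ * ‖a‖ * ‖f‖) := by
    rw [← inner_self_eq_norm_mul_norm (𝕜 := ℂ)]
    refine (RCLike.re_le_norm _).trans (hb.trans_eq ?_)
    ring
  rcases (norm_nonneg y).eq_or_lt with h0 | h0
  · rw [← h0]; positivity
  · exact le_of_mul_le_mul_left h1 h0

end Spread

/-- The constants in the spreading estimate tend to zero. -/
theorem exists_sqrt_log_div_le {ε : ℝ} (hε : 0 < ε) :
    ∃ k : ℕ, 2 ≤ k ∧ Real.sqrt (24 * (1 / k * Real.log k)) ≤ ε := by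
  have h1 : Filter.Tendsto (fun k : ℕ => Real.log k / (k : ℝ)) Filter.atTop (nhds 0) :=
    (Real.isLittleO_log_id_atTop.tendsto_div_nhds_zero).comp tendsto_natCast_atTop_atTop
  have h2 : Filter.Tendsto (fun k : ℕ => Real.sqrt (24 * (1 / k * Real.log k))) Filter.atTop
      (nhds 0) := by
    have := (h1.const_mul 24).sqrt
    rw [mul_zero, Real.sqrt_zero] at this
    refine this.congr fun k => ?_
    congr 1
    ring
  obtain ⟨k, hk, hk2⟩ :=
    ((h2.eventually_le_const hε).and (Filter.eventually_ge_atTop 2)).exists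
  exact ⟨k, hk2, hk⟩

end

/-! ### Assembly. -/

theorem theoremB {X : Type*} [MetricSpace X] (hX : UniformlyLocallyFinite X)
    (Y : ℕ → Finset X) (hY : IsExpanderSequence Y) :
    ∃ (m : ℕ → ℕ) (V : ℕ → Submodule ℂ (Ell2 X)) (_ : ∀ n, FiniteDimensional ℂ (V n)),
      StrictMono m ∧
      (∀ n, V n ≤ ell2On (Y (m n) : Set X)) ∧
      (∀ n, Module.finrank ℂ (V n) = n) ∧
      (Pairwise fun i j => V i ⟂ V j) ∧
      (∀ n k : ℕ, 2 ≤ k → k ≤ n → ∀ E ⊆ Y (m n),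
        (E.card : ℝ) / ((Y (m n)).card : ℝ) ≤ 1 / (k : ℝ) →
          ‖(V n).starProjection * coordProj (E : Set X)‖ <
            100 * Real.sqrt (1 / (k : ℝ) * Real.log (k : ℝ))) ∧
      ∃ φ : MatrixProduct →⋆ₙₐ[ℂ] quasiLocalAlgebra X,
        Function.Injective φ ∧
        (Set.range fun a => (φ a : BEll2 X)) = blockDiagonalOperators V := by
  classical
  obtain ⟨m, Z, q, hm, hZY, hZ, hq, hqZ, hYq⟩ := exists_disjoint_subsequence Y hY.1
  choose J hJZ hspread using fun n => exists_spread_isometry (hq n) (hqZ n)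
  have hJ := orthogonalFamily_of_disjoint hZ hJZ
  -- `J n c` lives on `Z n ⊆ Y (m n)`, so only points of `A` there matter, and `hYq` converts a
  -- proportion of `Y (m n)` into one of `q n * 2 ^ n`. The set `A` may be infinite, as
  -- quasi-locality requires.
  have spread : ∀ n k : ℕ, 2 ≤ k → ∀ (A : Set X) (E : Finset X),
      (∀ x ∈ Y (m n), x ∈ A → x ∈ E) → (E.card : ℝ) ≤ (Y (m n)).card / k → ∀ c,
      ‖coordProj A (J n c)‖ ≤ Real.sqrt (24 * (1 / k * Real.log k)) * ‖c‖ := by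
    intro n k hk A E hAE hE c
    rw [coordProj_eq_of_mem_ell2On (B := (({x ∈ Z n | x ∈ A} : Finset X) : Set X))
      (S := (Z n : Set X)) (by ext x; simp; tauto) (hJZ n c)]
    refine hspread n k hk _ (Finset.filter_subset _ _) ?_ c
    calc _ ≤ (E.card : ℝ) := by
          refine Nat.cast_le.2 (Finset.card_le_card fun x hx => ?_)
          rw [Finset.mem_filter] at hx
          exact hAE x (hZY n hx.1) hx.2
      _ ≤ (Y (m n)).card / k := hE
      _ ≤ _ := by
          gcongr
          exact_mod_cast hYq n
  have quasi : ∀ a, IsQuasiLocal (blockOperator hJ a) := by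
    intro a ε hε
    -- `k` depends only on `ε` and `‖a‖`, so the resulting distance `D` serves all blocks at once.
    obtain ⟨k, hk, hkε⟩ := exists_sqrt_log_div_le (ε := ε / (‖a‖ + 1)) (by positivity)
    obtain ⟨D, hD, hfar⟩ := hY.exists_dist (k := k) (by omega)
    refine ⟨D, hD, fun A B hAB => ?_⟩
    refine (norm_coordProj_blockOperator_le hZ hJZ hJ a (Real.sqrt_nonneg _) fun n => ?_).trans
      (b := Real.sqrt (24 * (1 / k * Real.log k)) * ‖a‖) ?_
    · refine (hfar (m n) {x ∈ Y (m n) | x ∈ A} (Finset.filter_subset _ _)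
        {x ∈ Y (m n) | x ∈ B} (Finset.filter_subset _ _) fun x hx y hy => ?_).imp
        (spread n k hk A _ fun x hx hxA => Finset.mem_filter.2 ⟨hx, hxA⟩)
        (spread n k hk B _ fun x hx hxB => Finset.mem_filter.2 ⟨hx, hxB⟩)
      exact lt_dist_of_lt_setDist hAB (Finset.mem_filter.1 hx).2 (Finset.mem_filter.1 hy).2
    · calc _ ≤ ε / (‖a‖ + 1) * (‖a‖ + 1) := by gcongr; linarith
        _ = ε := div_mul_cancel₀ _ (by positivity)
  refine ⟨m, fun n => LinearMap.range (J n).toLinearMap, fun n => inferInstance, hm, ?_, ?_, ?_,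
    ?_, ⟨⟨⟨⟨fun a => ⟨blockOperator hJ a, quasi a⟩, ?_⟩, ?_, ?_⟩, ?_⟩, ?_⟩, ?_, ?_⟩
  · rintro n _ ⟨c, rfl⟩ x hx
    exact hJZ n c x fun h => hx (hZY n h)
  · intro n
    rw [LinearMap.finrank_range_of_inj (J n).injective]
    simp
  · intro i j hij
    rw [Submodule.isOrtho_iff_inner_eq]
    rintro _ ⟨v, rfl⟩ _ ⟨w, rfl⟩
    exact hJ hij v w
  · intro n k hk _ E hE hcard
    have hk2 : (2 : ℝ) ≤ k := by exact_mod_cast hk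
    have hlog : 0 < Real.log k := Real.log_pos (by linarith)
    refine (norm_starProjection_range_mul_coordProj_le (Real.sqrt_nonneg _)
      (spread n k hk (E : Set X) E (fun x _ hx => hx) ?_)).trans_lt ?_
    · rcases (Nat.cast_nonneg (α := ℝ) (Y (m n)).card).eq_or_lt with h0 | h0
      -- If `Y (m n)` were empty, the quotient in `hcard` would be `0` by convention and carry no
      -- information, but `E` is then empty as well.
      · have : (E.card : ℝ) ≤ (Y (m n)).card := by exact_mod_cast Finset.card_le_card hE
        rw [← h0] at this ⊢
        simpa using this
      · rw [div_le_iff₀ h0] at hcard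
        rw [div_eq_mul_one_div, mul_comm]
        exact hcard
    -- The estimate with `√24` is far below `100`; strictness uses `log k > 0`.
    · rw [show (100 : ℝ) = Real.sqrt (100 ^ 2) by rw [Real.sqrt_sq]; norm_num,
        ← Real.sqrt_mul (by positivity)]
      apply Real.sqrt_lt_sqrt (by positivity)
      have : 0 < 1 / (k : ℝ) * Real.log k := by positivity
      nlinarith
  · exact fun c a => Subtype.ext (blockOperator_smul hJ c a)
  · refine Subtype.ext ?_
    have := blockOperator_smul hJ 0 0
    rwa [zero_smul, zero_smul] at this
  · exact fun a b => Subtype.ext (blockOperator_add hJ a b)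
  · exact fun a b => Subtype.ext (blockOperator_mul hJ a b)
  · exact fun a => Subtype.ext (blockOperator_star hJ a)
  · exact fun a b hab => blockOperator_injective hJ (congrArg Subtype.val hab)
  · exact range_blockOperator hJ
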